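/- A \emph{curve} in a metric space $(Z,d)$ is a continuous map $\gamma:[a,b]\to Z$; its length $\ell_Z(\gamma)\in[0,\infty]$ is the supremum of $\sum_i d(\gamma(t_i),\gamma(t_{i+1}))$ over all finite partitions of $[a,b]$, and $\gamma$ is \emph{rectifiable} if $\ell_Z(\gamma)<\infty$; the length of a map $[a,b]\to Z$ that is not known to be continuous is defined by the same formula. A metric space $(X,d_X)$ is \emph{quasiconvex} if there is a constant $C_q\ge 1$ such that any $x,y\in X$ can be connected by a rectifiable curve $\gamma:[0,1]\to X$, $\gamma(0)=x$, $\gamma(1)=y$, with $\ell_X(\gamma)\le C_q\,d_X(x,y)$. A map $\Phi:X\to Y$ between metric spaces is \emph{weak BLD} (of weak bounded length distortion) if there is a constant $M\ge 1$ such that $$M^{-1}\ell_X(\gamma)\le \ell_Y(\Phi\circ\gamma)\le M\,\ell_X(\gamma)$$ for all rectifiable curves $\gamma$ in $X$. $\mathcal H^k$ denotes the $k$-dimensional Hausdorff measure. \textbf{Theorem.} Let $(X,d_X)$ be a complete and quasiconvex metric space, let $(Y,d_Y)$ be any metric space, and let $\Phi:X\to Y$ be a weak BLD mapping. Then for any $k\in\mathbb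 N$ and any Lipschitz map $f:E\to X$ defined on a (Lebesgue) measurable set $E\subset\mathbb R^k$, the following conditions are equivalent: (1) $\mathcal H^k(f(E))=0$ in $X$; (2) $\mathcal H^k(\Phi(f(E)))=0$ in $Y$. -/

import Mathlib

open MeasureTheory
open scoped ENNReal NNReal

/-- The length of the curve `γ` on `[a, b]`: the supremum of `∑ d(γ tᵢ, γ tᵢ₊₁)` over all finite
partitions of `[a, b]`. Only the values of `γ` on `[a, b]` matter. -/
noncomputable def curveLength {Z : Type*} [MetricSpace Z] (γ : ℝ → Z) (a b : ℝ) : ℝ≥0∞ :=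
  eVariationOn γ (Set.Icc a b)

/-- `γ` restricted to `[a, b]` is a rectifiable curve: continuous and of finite length. -/
def IsRectifiableCurve {Z : Type*} [MetricSpace Z] (γ : ℝ → Z) (a b : ℝ) : Prop :=
  a ≤ b ∧ ContinuousOn γ (Set.Icc a b) ∧ curveLength γ a b < ∞

/-- Quasiconvex metric space: for some `C ≥ 1`, any two points `x`, `y` are joined by a rectifiable
curve on `[0, 1]` of length at most `C * d(x, y)`. -/
def IsQuasiconvexSpace (X : Type*) [MetricSpace X] : Prop :=
  ∃ C : ℝ≥0, 1 ≤ C ∧ ∀ x y : X, ∃ γ : ℝ → X, IsRectifiableCurve γ 0 1 ∧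
    γ 0 = x ∧ γ 1 = y ∧ curveLength γ 0 1 ≤ C * edist x y

/-- Weak bounded length distortion: for some `M ≥ 1`, every rectifiable curve `γ` satisfies
`M⁻¹ ℓ(γ) ≤ ℓ(Φ ∘ γ) ≤ M ℓ(γ)`. -/
def IsWeakBLD {X Y : Type*} [MetricSpace X] [MetricSpace Y] (Φ : X → Y) : Prop :=
  ∃ M : ℝ≥0, 1 ≤ M ∧ ∀ (a b : ℝ) (γ : ℝ → X), IsRectifiableCurve γ a b →
    (M : ℝ≥0∞)⁻¹ * curveLength γ a b ≤ curveLength (Φ ∘ γ) a b ∧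
      curveLength (Φ ∘ γ) a b ≤ M * curveLength γ a b

/-! A weak BLD map on a quasiconvex space is Lipschitz, so it preserves null sets. For the converse
put `g = Φ ∘ f`. The distances from `g` to a countable dense subset of `g(E)` recover the metric on
`g(E)`. Any `k` of them form a Lipschitz function of `g`; if `g(E)` is null, this function has null
image and its Jacobian vanishes almost everywhere. Hence at almost every point the differentials of
all these functions share a kernel vector `v`: infinitesimally, `g` does not move in direction `v`.

The lower length bound carries this degeneracy back to `f`. On a line in direction `v`, `f` is
controlled only on a closed subset, so the gaps are filled by quasiconvex paths. The `Φ`-image of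
the resulting curve has speed at most `ε` on the subset and bounded speed on the gaps, so `f` moves
little between points of a line lying mostly in the good set (`dist_le_of_weakBLD`). Near a density
point, Fubini supplies such lines (`exists_dist_le_of_tendsto_density`). There `f` is Lipschitz with
respect to a linear map of determinant `ε` that contracts `v`, so the image has measure `O(ε)`
(`hausdorffMeasure_image_le_of_local_dist_le`). Countably many directions suffice up to the error
`ε`, and `ε → 0` concludes. -/

open Set Filter Topology

/-! ### Arclength and Lipschitz paths -/

/-- The variation function of a continuous function of bounded variation is continuous. -/
theorem BoundedVariationOn.continuousOn_variationOnFromTo {Z : Type*} [PseudoMetricSpace Z]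
    {γ : ℝ → Z} {s : Set ℝ} (hγ : BoundedVariationOn γ s) (hc : ContinuousOn γ s) {a : ℝ}
    (ha : a ∈ s) : ContinuousOn (variationOnFromTo γ s a) s := by
  intro x hx
  have hl := hγ.locallyBoundedVariationOn
  rw [ContinuousWithinAt, tendsto_iff_dist_tendsto_zero]
  have h1 := hγ.tendsto_eVariationOn_Icc_zero_left (x := x)
    ((hc x hx).mono inter_subset_left)
  have h2 := hγ.tendsto_eVariationOn_Icc_zero_right x
    ((hc x hx).mono inter_subset_left)
  have h1' := (ENNReal.tendsto_toReal ENNReal.zero_ne_top).comp h1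
  have h2' := (ENNReal.tendsto_toReal ENNReal.zero_ne_top).comp h2
  -- Whichever side of `x` the point `y` lies on, one summand is the variation between them, so the
  -- sum dominates in both cases.
  have h3 := h1'.add h2'
  simp only [ENNReal.toReal_zero, add_zero] at h3
  refine squeeze_zero' (Eventually.of_forall fun _ => dist_nonneg) ?_ h3
  filter_upwards [self_mem_nhdsWithin] with y hy
  have hadd := variationOnFromTo.add hl ha hx hy
  have : dist (variationOnFromTo γ s a y) (variationOnFromTo γ s a x)
      = |variationOnFromTo γ s x y| := by
    rw [Real.dist_eq, ← hadd]; congr 1; ring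
  rw [this]
  simp only [Function.comp]
  rcases le_total x y with h | h
  · rw [variationOnFromTo.eq_of_le _ _ h, abs_of_nonneg ENNReal.toReal_nonneg]
    linarith [@ENNReal.toReal_nonneg (eVariationOn γ (s ∩ Icc y x))]
  · rw [variationOnFromTo.eq_of_ge _ _ h, abs_neg, abs_of_nonneg ENNReal.toReal_nonneg]
    linarith [@ENNReal.toReal_nonneg (eVariationOn γ (s ∩ Icc x y))]

/-- A rectifiable curve of length at most `l` can be reparametrized on `[0, 1]` to be
`l`-Lipschitz. -/
theorem IsRectifiableCurve.exists_lipschitzOnWith {Z : Type*} [MetricSpace Z] {γ : ℝ → Z}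
    (hγ : IsRectifiableCurve γ 0 1) {l : ℝ≥0} (hl : curveLength γ 0 1 ≤ l) :
    ∃ c : ℝ → Z, LipschitzOnWith l c (Icc 0 1) ∧ c 0 = γ 0 ∧ c 1 = γ 1 := by
  obtain ⟨-, hc, hfin⟩ := hγ
  unfold curveLength at hl hfin
  have hbv : BoundedVariationOn γ (Icc 0 1) := hfin.ne
  have hloc := hbv.locallyBoundedVariationOn
  have m0 : (0 : ℝ) ∈ Icc (0 : ℝ) 1 := by simp
  have m1 : (1 : ℝ) ∈ Icc (0 : ℝ) 1 := by simp
  set V := variationOnFromTo γ (Icc 0 1) 0 with hV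
  have hV0 : V 0 = 0 := variationOnFromTo.self _ _ _
  have hV1 : V 1 = (eVariationOn γ (Icc 0 1)).toReal := by
    rw [hV, variationOnFromTo.eq_of_le _ _ zero_le_one, inter_self]
  have hV1' : V 1 ≤ l := by
    rw [hV1]; exact ENNReal.toReal_le_of_le_ofReal l.2 (by simpa using hl)
  have hV1n : 0 ≤ V 1 := by rw [hV1]; exact ENNReal.toReal_nonneg
  have hcont : ContinuousOn V (Icc 0 1) := hbv.continuousOn_variationOnFromTo hc m0
  -- Continuity of `γ` is needed here: the arclength parametrization is controlled only on the image
  -- of `V`, which must not skip values.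
  have himg : Icc 0 (V 1) ⊆ V '' Icc 0 1 := by
    have := intermediate_value_Icc zero_le_one hcont
    rwa [hV0] at this
  set N := naturalParameterization γ (Icc 0 1) 0
  have hN := has_unit_speed_naturalParameterization γ hloc m0
  have key : ∀ u ∈ Icc (0 : ℝ) 1, V 1 * u ∈ V '' Icc 0 1 := fun u hu =>
    himg ⟨mul_nonneg hV1n hu.1, mul_le_of_le_one_right hV1n hu.2⟩
  have hle : ∀ u ∈ Icc (0 : ℝ) 1, ∀ u' ∈ Icc (0 : ℝ) 1, u ≤ u' →
      edist (N (V 1 * u)) (N (V 1 * u')) ≤ l * edist u u' := by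
    intro u hu u' hu' huu
    have hmul : V 1 * u ≤ V 1 * u' := mul_le_mul_of_nonneg_left huu hV1n
    have h1 := hN (key u hu) (key u' hu')
    have h2 := eVariationOn.edist_le N (s := V '' Icc 0 1 ∩ Icc (V 1 * u) (V 1 * u'))
      ⟨key u hu, le_rfl, hmul⟩ ⟨key u' hu', hmul, le_rfl⟩
    refine h2.trans (h1.le.trans ?_)
    rw [edist_dist, Real.dist_eq, abs_sub_comm, abs_of_nonneg (sub_nonneg.2 huu),
      ← ENNReal.ofReal_coe_nnreal, ← ENNReal.ofReal_mul (NNReal.coe_nonneg l)]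
    apply ENNReal.ofReal_le_ofReal
    have := mul_le_mul_of_nonneg_right hV1' (sub_nonneg.2 huu)
    simp only [NNReal.coe_one]
    linarith
  have hNV : ∀ b ∈ Icc (0 : ℝ) 1, N (V b) = γ b := fun b hb =>
    edist_eq_zero.1 (edist_naturalParameterization_eq_zero hloc m0 hb)
  refine ⟨fun u => N (V 1 * u), ?_, ?_, ?_⟩
  · intro u hu u' hu'
    rcases le_total u u' with h | h
    · exact hle u hu u' hu' h
    · rw [edist_comm, edist_comm u]; exact hle u' hu' u hu h
  · have := hNV 0 m0; rw [hV0] at this; simpa using this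
  · simpa using hNV 1 m1

/-- In a quasiconvex space, any two points are joined by a Lipschitz curve on `[0, 1]` whose
Lipschitz constant is comparable to their distance. -/
theorem IsQuasiconvexSpace.exists_lipschitz_paths {X : Type*} [MetricSpace X]
    (hX : IsQuasiconvexSpace X) : ∃ C : ℝ≥0, 1 ≤ C ∧ ∀ x y : X, ∃ c : ℝ → X,
      LipschitzOnWith (C * nndist x y) c (Icc 0 1) ∧ c 0 = x ∧ c 1 = y := by
  obtain ⟨C, hC, h⟩ := hX
  refine ⟨C, hC, fun x y => ?_⟩
  obtain ⟨γ, hγ, rfl, rfl, hl⟩ := h x y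
  exact hγ.exists_lipschitzOnWith (by rw [ENNReal.coe_mul, ← edist_nndist]; exact hl)

/-- A weak BLD map on a quasiconvex space is Lipschitz. -/
theorem IsWeakBLD.exists_lipschitzWith {X Y : Type*} [MetricSpace X] [MetricSpace Y]
    (hX : IsQuasiconvexSpace X) {Φ : X → Y} (hΦ : IsWeakBLD Φ) :
    ∃ K : ℝ≥0, LipschitzWith K Φ := by
  obtain ⟨C, hC, h⟩ := hX
  obtain ⟨M, hM, h'⟩ := hΦ
  refine ⟨M * C, fun x y => ?_⟩
  obtain ⟨γ, hγ, rfl, rfl, hl⟩ := h x y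
  calc edist (Φ (γ 0)) (Φ (γ 1)) ≤ curveLength (Φ ∘ γ) 0 1 :=
        eVariationOn.edist_le (Φ ∘ γ) (s := Icc 0 1) (by simp) (by simp)
    _ ≤ M * curveLength γ 0 1 := (h' 0 1 γ hγ).2
    _ ≤ M * (C * edist (γ 0) (γ 1)) := by gcongr
    _ = _ := by rw [ENNReal.coe_mul, mul_assoc]

/-! ### Filling the gaps of a closed subset of the line -/

/-- The left and right neighbours in a closed set `F` of a point between two points of `F`. -/
theorem IsClosed.exists_neighbours {F : Set ℝ} (hF : IsClosed F) {a b : ℝ} (ha : a ∈ F)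
    (hb : b ∈ F) {s : ℝ} (hs : s ∈ Icc a b) :
    ∃ p q, p ∈ F ∧ q ∈ F ∧ a ≤ p ∧ p ≤ s ∧ s ≤ q ∧ q ≤ b ∧
      (∀ t ∈ F, t ≤ s → t ≤ p) ∧ ∀ t ∈ F, s ≤ t → q ≤ t := by
  have hp : IsGreatest (F ∩ Icc a s) (sSup (F ∩ Icc a s)) :=
    ((isCompact_Icc.inter_left hF)).isGreatest_sSup ⟨a, ha, le_rfl, hs.1⟩
  have hq : IsLeast (F ∩ Icc s b) (sInf (F ∩ Icc s b)) :=
    ((isCompact_Icc.inter_left hF)).isLeast_sInf ⟨b, hb, hs.2, le_rfl⟩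
  refine ⟨_, _, hp.1.1, hq.1.1, hp.1.2.1, hp.1.2.2, hq.1.2.1, hq.1.2.2, fun t ht hts => ?_,
    fun t ht hst => ?_⟩
  · by_cases h : a ≤ t
    · exact hp.2 ⟨ht, h, hts⟩
    · exact (not_le.1 h).le.trans hp.1.2.1
  · by_cases h : t ≤ b
    · exact hq.2 ⟨ht, hst, h⟩
    · exact hq.1.2.2.trans (not_le.1 h).le

/-- A Lipschitz map from a closed subset of the line to a space with Lipschitz paths extends to a
Lipschitz curve. -/
theorem LipschitzOnWith.exists_extend_Icc {X : Type*} [MetricSpace X] {C L : ℝ≥0} (hC : 1 ≤ C)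
    (hX : ∀ x y : X, ∃ c : ℝ → X, LipschitzOnWith (C * nndist x y) c (Icc 0 1) ∧ c 0 = x ∧ c 1 = y)
    {F : Set ℝ} (hF : IsClosed F) {a b : ℝ} (ha : a ∈ F) (hb : b ∈ F) {h : ℝ → X}
    (hh : LipschitzOnWith L h F) :
    ∃ γ : ℝ → X, LipschitzOnWith (C * L) γ (Icc a b) ∧ ∀ s ∈ F ∩ Icc a b, γ s = h s := by
  choose c hcl hc0 hc1 using hX
  have hex : ∀ s : ℝ, ∃ p q, s ∈ Icc a b → p ∈ F ∧ q ∈ F ∧ a ≤ p ∧ p ≤ s ∧ s ≤ q ∧ q ≤ b ∧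
      (∀ t ∈ F, t ≤ s → t ≤ p) ∧ ∀ t ∈ F, s ≤ t → q ≤ t := by
    intro s
    by_cases hs : s ∈ Icc a b
    · obtain ⟨p, q, H⟩ := hF.exists_neighbours ha hb hs
      exact ⟨p, q, fun _ => H⟩
    · exact ⟨0, 0, fun h => absurd h hs⟩
  choose p q hpq using hex
  -- A gap is crossed along a quasiconvex path at affine speed. At a point of `F` both neighbours
  -- equal `s`, the quotient is `0 / 0 = 0`, and the path starts at `h s`.
  set γ : ℝ → X := fun s => c (h (p s)) (h (q s)) ((s - p s) / (q s - p s)) with hγ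
  have hγF : ∀ s ∈ F ∩ Icc a b, γ s = h s := by
    rintro s ⟨hsF, hs⟩
    obtain ⟨-, -, -, h1, h2, -, h3, h4⟩ := hpq s hs
    have e1 : p s = s := le_antisymm h1 (h3 s hsF le_rfl)
    have e2 : q s = s := le_antisymm (h4 s hsF le_rfl) h2
    simp [hγ, e1, e2, hc0]
  have hgap : ∀ u ∈ F, ∀ w ∈ F, u < w → ∀ s ∈ Icc u w, ∀ s' ∈ Icc u w,
      dist (c (h u) (h w) ((s - u) / (w - u))) (c (h u) (h w) ((s' - u) / (w - u)))
        ≤ C * L * dist s s' := by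
    intro u hu w hw huw s hs s' hs'
    have hpos : 0 < w - u := sub_pos.2 huw
    have mem : ∀ t ∈ Icc u w, (t - u) / (w - u) ∈ Icc (0 : ℝ) 1 := fun t ht =>
      ⟨div_nonneg (sub_nonneg.2 ht.1) hpos.le, (div_le_one hpos).2 (by linarith [ht.2])⟩
    have h1 := (hcl (h u) (h w)).dist_le_mul _ (mem s hs) _ (mem s' hs')
    have h2 := hh.dist_le_mul u hu w hw
    have h3 : dist ((s - u) / (w - u)) ((s' - u) / (w - u)) = dist s s' / (w - u) := by
      rw [Real.dist_eq, Real.dist_eq, ← sub_div, abs_div, abs_of_pos hpos]; congr 2; ring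
    have h4 : dist u w = w - u := by rw [dist_comm, Real.dist_eq, abs_of_pos hpos]
    rw [h3] at h1
    rw [h4] at h2
    refine h1.trans ?_
    push_cast
    calc C * dist (h u) (h w) * (dist s s' / (w - u))
        ≤ C * (L * (w - u)) * (dist s s' / (w - u)) := by gcongr
      _ = C * L * dist s s' := by field_simp
  have hright : ∀ s ∈ Icc a b, dist (γ s) (h (q s)) ≤ C * L * (q s - s) := by
    intro s hs
    obtain ⟨hp, hq, -, h1, h2, -, -, -⟩ := hpq s hs
    rcases (h1.trans h2).lt_or_eq with hlt | heq
    · have := hgap _ hp _ hq hlt s ⟨h1, h2⟩ (q s) ⟨hlt.le, le_rfl⟩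
      rwa [div_self (sub_pos.2 hlt).ne', hc1, dist_comm s, Real.dist_eq,
        abs_of_nonneg (sub_nonneg.2 h2)] at this
    · have e : q s = s := le_antisymm (heq ▸ h1) h2
      rw [e, hγF s ⟨e ▸ hq, hs⟩]; simp
  have hleft : ∀ s ∈ Icc a b, dist (h (p s)) (γ s) ≤ C * L * (s - p s) := by
    intro s hs
    obtain ⟨hp, hq, -, h1, h2, -, -, -⟩ := hpq s hs
    rcases (h1.trans h2).lt_or_eq with hlt | heq
    · have := hgap _ hp _ hq hlt (p s) ⟨le_rfl, hlt.le⟩ s ⟨h1, h2⟩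
      rwa [sub_self, zero_div, hc0, dist_comm _ s, Real.dist_eq,
        abs_of_nonneg (sub_nonneg.2 h1)] at this
    · have e : p s = s := le_antisymm h1 (heq ▸ h2)
      rw [e, hγF s ⟨e ▸ hp, hs⟩]; simp
  have hmain : ∀ s ∈ Icc a b, ∀ s' ∈ Icc a b, s ≤ s' → dist (γ s) (γ s') ≤ C * L * (s' - s) := by
    intro s hs s' hs' hss
    obtain ⟨hp, hq, ap, ps, sq, qb, pmax, qmin⟩ := hpq s hs
    obtain ⟨hp', hq', ap', ps', sq', qb', pmax', qmin'⟩ := hpq s' hs'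
    -- Either the gap of `s` closes before `s'`, and the route passes through `q s` and `p s'` in
    -- `F`, or both points lie in the same gap.
    by_cases hcase : q s ≤ s'
    · have h1 := hright s hs
      have h2 := hleft s' hs'
      have hqp : q s ≤ p s' := pmax' _ hq hcase
      have h3 := hh.dist_le_mul _ hq _ hp'
      rw [dist_comm (q s), Real.dist_eq, abs_of_nonneg (sub_nonneg.2 hqp)] at h3
      have hCL : (L : ℝ) ≤ C * L := le_mul_of_one_le_left L.2 (by exact_mod_cast hC)
      have h4 : (L : ℝ) * (p s' - q s) ≤ C * L * (p s' - q s) :=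
        mul_le_mul_of_nonneg_right hCL (sub_nonneg.2 hqp)
      have := dist_triangle4 (γ s) (h (q s)) (h (p s')) (γ s')
      linarith
    · push Not at hcase
      have e1 : q s' = q s := le_antisymm (qmin' _ hq hcase.le) (qmin _ hq' (hss.trans sq'))
      have e2 : p s' = p s := by
        refine le_antisymm (pmax _ hp' ?_) (pmax' _ hp (ps.trans hss))
        by_contra hlt
        exact absurd (qmin _ hp' (not_le.1 hlt).le) (not_le.2 (ps'.trans_lt hcase))
      have := hgap _ hp _ hq (ps.trans_lt (hss.trans_lt hcase)) s ⟨ps, sq⟩ s'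
        ⟨ps.trans hss, hcase.le⟩
      rw [dist_comm s, Real.dist_eq, abs_of_nonneg (sub_nonneg.2 hss)] at this
      simpa only [hγ, e1, e2] using this
  refine ⟨γ, LipschitzOnWith.of_dist_le_mul fun s hs s' hs' => ?_, hγF⟩
  push_cast
  rcases le_total s s' with hss | hss
  · rw [dist_comm s, Real.dist_eq, abs_of_nonneg (sub_nonneg.2 hss)]
    exact hmain s hs s' hs' hss
  · rw [dist_comm, Real.dist_eq, abs_of_nonneg (sub_nonneg.2 hss)]
    exact hmain s' hs' s hs hss

/-! ### The weak BLD estimate along a line -/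

/-- A Lipschitz function on the line whose derivative is at most `ε` on `F` varies slowly along
intervals mostly contained in `F`. -/
theorem LipschitzWith.abs_sub_le_of_abs_deriv_le {G : ℝ → ℝ} {K : ℝ≥0} (hG : LipschitzWith K G)
    {F : Set ℝ} (hF : MeasurableSet F) {ε : ℝ} (hε : 0 ≤ ε) (hd : ∀ s ∈ F, |deriv G s| ≤ ε)
    {s t : ℝ} (hst : s ≤ t) :
    |G t - G s| ≤ ε * (t - s) + K * volume.real (Ioc s t \ F) := by
  have hac : AbsolutelyContinuousOnInterval G s t :=
    (hG.lipschitzOnWith).absolutelyContinuousOnInterval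
  -- The integrand majorizes `|G'|`: it is at least `ε` on `F` and at least the Lipschitz constant
  -- elsewhere.
  have hint : IntegrableOn (fun x => ε + Fᶜ.indicator (fun _ => (K : ℝ)) x) (Ioc s t) :=
    (integrable_const _).add ((integrable_const _).indicator hF.compl)
  rw [← hac.integral_deriv_eq_sub, intervalIntegral.integral_of_le hst, ← Real.norm_eq_abs]
  refine (norm_integral_le_of_norm_le hint (Eventually.of_forall fun x => ?_)).trans_eq ?_
  · by_cases hx : x ∈ F
    · simpa [hx] using hd x hx
    · simpa [hx] using (norm_deriv_le_of_lipschitz hG).trans (by linarith)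
  · rw [integral_add (integrable_const _) ((integrable_const _).indicator hF.compl),
      integral_indicator hF.compl, Measure.restrict_restrict hF.compl]
    simp [measureReal_def, hst, inter_comm, sdiff_eq, mul_comm]

/-- Control of the variation of a map by the increments of a real function. -/
theorem eVariationOn_Icc_le_of_dist_le {Z : Type*} [PseudoMetricSpace Z] {q : ℝ → Z} {m : ℝ → ℝ}
    {a b : ℝ} (hab : a ≤ b)
    (h : ∀ s ∈ Icc a b, ∀ t ∈ Icc a b, s ≤ t → dist (q s) (q t) ≤ m t - m s) :
    eVariationOn q (Icc a b) ≤ ENNReal.ofReal (m b - m a) := by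
  have hmono : MonotoneOn m (Icc a b) := fun s hs t ht hst =>
    sub_nonneg.1 (dist_nonneg.trans (h s hs t ht hst))
  have h1 : eVariationOn m (Icc a b) ≤ ENNReal.ofReal (m b - m a) := by
    have := (hmono.eVariationOn_eq (left_mem_Icc.2 hab) (right_mem_Icc.2 hab)).le
    rwa [inter_self] at this
  refine le_trans (iSup_le fun p => ?_) h1
  refine le_trans (Finset.sum_le_sum fun i _ => ?_) (eVariationOn.sum_le p.2.2.1 p.2.2.2)
  rw [edist_comm, edist_dist, edist_dist, Real.dist_eq]
  exact ENNReal.ofReal_le_ofReal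
    ((h _ (p.2.2.2 i) _ (p.2.2.2 (i + 1)) (p.2.2.1 (Nat.le_succ i))).trans (le_abs_self _))

/-- If a Lipschitz map `h` on a closed subset `F` of the line is such that `Φ ∘ h` has metric
derivative at most `ε` on `F` (tested on the functions `G i`), then `h` moves little along `F`. -/
theorem dist_le_of_weakBLD {X Y : Type*} [MetricSpace X] [MetricSpace Y] {Φ : X → Y}
    {M C L KΦ K : ℝ≥0} (hM : 1 ≤ M)
    (hBLD : ∀ (a b : ℝ) (γ : ℝ → X), IsRectifiableCurve γ a b →
      (M : ℝ≥0∞)⁻¹ * curveLength γ a b ≤ curveLength (Φ ∘ γ) a b)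
    (hC : 1 ≤ C) (hΦ : LipschitzWith KΦ Φ)
    (hX : ∀ x y : X, ∃ c : ℝ → X, LipschitzOnWith (C * nndist x y) c (Icc 0 1) ∧ c 0 = x ∧ c 1 = y)
    {F : Set ℝ} (hF : IsClosed F) {a b : ℝ} (ha : a ∈ F) (hb : b ∈ F) (hab : a ≤ b) {h : ℝ → X}
    (hh : LipschitzOnWith L h F) (hK : KΦ * (C * L) ≤ K) {ι : Type*} {G : ι → ℝ → ℝ}
    (hG : ∀ i, LipschitzWith K (G i)) {ε : ℝ} (hε : 0 ≤ ε)
    (hd : ∀ i, ∀ s ∈ F, |deriv (G i) s| ≤ ε)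
    (hdist : ∀ s ∈ F, ∀ t ∈ F, ∀ η > 0, ∃ i, dist (Φ (h s)) (Φ (h t)) ≤ |G i t - G i s| + η) :
    dist (h a) (h b) ≤ M * (ε * (b - a) + K * volume.real (Ioc a b \ F)) := by
  obtain ⟨γ, hγL, hγF⟩ := hh.exists_extend_Icc hC hX hF ha hb
  -- The increments of `m` will bound those of `Φ ∘ γ`, hence its length: rate `ε`, plus `K` times
  -- the length of the gaps.
  set m : ℝ → ℝ := fun s => ε * s + K * volume.real (Ioc a s \ F) with hm
  have hfin : ∀ s t : ℝ, volume (Ioc s t \ F) ≠ ∞ := fun s t =>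
    (measure_mono sdiff_subset).trans_lt (by simp) |>.ne
  have hadd : ∀ s t u : ℝ, s ≤ t → t ≤ u →
      volume.real (Ioc s u \ F) = volume.real (Ioc s t \ F) + volume.real (Ioc t u \ F) := by
    intro s t u hst htu
    rw [← Ioc_union_Ioc_eq_Ioc hst htu, union_sdiff_distrib]
    exact measureReal_union ((Ioc_disjoint_Ioc_of_le le_rfl).mono sdiff_subset sdiff_subset)
      (measurableSet_Ioc.diff hF.measurableSet) (hfin _ _) (hfin _ _)
  have hm_sub : ∀ s t, a ≤ s → s ≤ t → m t - m s = ε * (t - s) + K * volume.real (Ioc s t \ F) := by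
    intro s t hs hst
    simp only [hm]
    rw [hadd a s t hs hst]; ring
  set q : ℝ → Y := Φ ∘ γ with hq
  have hqL : LipschitzOnWith K q (Icc a b) :=
    (hΦ.comp_lipschitzOnWith hγL).weaken hK
  have hqF : ∀ s ∈ F ∩ Icc a b, ∀ t ∈ F ∩ Icc a b, s ≤ t → dist (q s) (q t) ≤ m t - m s := by
    intro s hs t ht hst
    rw [hm_sub s t hs.2.1 hst]
    refine le_of_forall_pos_le_add fun η hη => ?_
    obtain ⟨i, hi⟩ := hdist s hs.1 t ht.1 η hη
    simp only [hq, Function.comp, hγF s hs, hγF t ht]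
    refine hi.trans ?_
    gcongr
    exact (hG i).abs_sub_le_of_abs_deriv_le hF.measurableSet hε (hd i) hst
  have hgap : ∀ s ∈ Icc a b, ∀ t ∈ Icc a b, s ≤ t → Ioo s t ∩ F = ∅ →
      dist (q s) (q t) ≤ m t - m s := by
    intro s hs t ht hst hemp
    rw [hm_sub s t hs.1 hst]
    have h1 : t - s ≤ volume.real (Ioc s t \ F) := by
      have : Ioo s t ⊆ Ioc s t \ F := fun x hx =>
        ⟨Ioo_subset_Ioc_self hx, fun hxF =>
          (hemp ▸ (⟨hx, hxF⟩ : x ∈ Ioo s t ∩ F) : x ∈ (∅ : Set ℝ))⟩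
      have := measureReal_mono this (hfin s t)
      simpa [measureReal_def, hst] using this
    have h2 := hqL.dist_le_mul s hs t ht
    rw [dist_comm s, Real.dist_eq, abs_of_nonneg (sub_nonneg.2 hst)] at h2
    have h3 := mul_le_mul_of_nonneg_left h1 K.2
    have h4 := mul_nonneg hε (sub_nonneg.2 hst)
    simp only [NNReal.val_eq_coe] at h3
    linarith
  have hall : ∀ s ∈ Icc a b, ∀ t ∈ Icc a b, s ≤ t → dist (q s) (q t) ≤ m t - m s := by
    intro s hs t ht hst
    obtain ⟨-, u, -, huF, -, -, hsu, hub, -, hu⟩ := hF.exists_neighbours ha hb hs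
    obtain ⟨w, -, hwF, -, haw, hwt, -, -, hw, -⟩ := hF.exists_neighbours ha hb ht
    -- Split at the first and last points of `F` between `s` and `t`; if there are none, the whole
    -- interval is in a gap.
    by_cases hut : u ≤ t
    · have huw : u ≤ w := hw u huF hut
      have hu' : u ∈ Icc a b := ⟨hs.1.trans hsu, hub⟩
      have hw' : w ∈ Icc a b := ⟨haw, hwt.trans ht.2⟩
      have h1 := hgap s hs u hu' hsu (by
        ext x; simp only [mem_inter_iff, mem_Ioo, mem_empty_iff_false, iff_false]
        rintro ⟨⟨h1, h2⟩, h3⟩; exact absurd (hu x h3 h1.le) (not_le.2 h2))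
      have h2 := hqF u ⟨huF, hu'⟩ w ⟨hwF, hw'⟩ huw
      have h3 := hgap w hw' t ht hwt (by
        ext x; simp only [mem_inter_iff, mem_Ioo, mem_empty_iff_false, iff_false]
        rintro ⟨⟨h1, h2⟩, h3⟩; exact absurd (hw x h3 h2.le) (not_le.2 h1))
      have := dist_triangle4 (q s) (q u) (q w) (q t)
      linarith
    · refine hgap s hs t ht hst ?_
      ext x; simp only [mem_inter_iff, mem_Ioo, mem_empty_iff_false, iff_false]
      rintro ⟨⟨h1, h2⟩, h3⟩
      exact hut ((hu x h3 h1.le).trans h2.le)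
  have hlen : curveLength (Φ ∘ γ) a b ≤ ENNReal.ofReal (m b - m a) :=
    eVariationOn_Icc_le_of_dist_le hab hall
  have hγlen : curveLength γ a b < ∞ := by
    have h1 := hγL.locallyBoundedVariationOn a b (left_mem_Icc.2 hab) (right_mem_Icc.2 hab)
    rw [inter_self] at h1
    exact lt_top_iff_ne_top.2 h1
  have h1 := (hBLD a b γ ⟨hab, hγL.continuousOn, hγlen⟩).trans hlen
  have hM0 : (M : ℝ≥0∞) ≠ 0 := by
    have : M ≠ 0 := (zero_lt_one.trans_le hM).ne'
    exact_mod_cast this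
  have h2 : curveLength γ a b ≤ M * ENNReal.ofReal (m b - m a) := by
    rw [← ENNReal.div_eq_inv_mul] at h1
    rw [mul_comm]
    exact (ENNReal.div_le_iff hM0 ENNReal.coe_ne_top).1 h1
  have h3 : edist (γ a) (γ b) ≤ M * ENNReal.ofReal (m b - m a) :=
    (eVariationOn.edist_le γ (left_mem_Icc.2 hab) (right_mem_Icc.2 hab)).trans h2
  rw [hγF a ⟨ha, left_mem_Icc.2 hab⟩, hγF b ⟨hb, right_mem_Icc.2 hab⟩,
    ← ENNReal.ofReal_coe_nnreal, ← ENNReal.ofReal_mul (NNReal.coe_nonneg M), edist_dist,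
    hm_sub a b le_rfl hab] at h3
  refine (ENNReal.ofReal_le_ofReal_iff ?_).1 h3
  have := sub_nonneg.2 hab
  positivity

/-! ### Common kernels of differentials -/

/-- A map with null image has singular derivative almost everywhere. -/
theorem addHaar_det_ne_zero_eq_zero_of_addHaar_image_eq_zero {E : Type*} [NormedAddCommGroup E]
    [NormedSpace ℝ E] [FiniteDimensional ℝ E] [MeasurableSpace E] [BorelSpace E] (μ : Measure E)
    [μ.IsAddHaarMeasure] {s : Set E} {f : E → E} {f' : E → E →L[ℝ] E}
    (hf' : ∀ x ∈ s, HasFDerivWithinAt f (f' x) s x) (h : μ (f '' s) = 0) :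
    μ {x ∈ s | (f' x).det ≠ 0} = 0 := by
  set S := {x ∈ s | (f' x).det ≠ 0} with hS
  have hSs : S ⊆ s := fun x hx => hx.1
  rcases S.eq_empty_or_nonempty with hemp | hne
  · simp [hemp]
  -- A map close enough to an invertible `A` on `t` multiplies the measure of `t` by at least `|det
  -- A| / 2`, so a null image forces `t` to be null. For singular `A` the value `1` is a dummy.
  have hex : ∀ A : E →L[ℝ] E, ∃ δ : ℝ≥0, δ ≠ 0 ∧ (A.det ≠ 0 → ∀ (t : Set E),
      ApproximatesLinearOn f A t δ → μ (f '' t) = 0 → μ t = 0) := by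
    intro A
    by_cases hA : A.det = 0
    · exact ⟨1, one_ne_zero, fun h => absurd hA h⟩
    · have hpos : 0 < |A.det| := abs_pos.2 hA
      set m : ℝ≥0 := (|A.det| / 2).toNNReal
      have hm0 : 0 < m := Real.toNNReal_pos.2 (half_pos hpos)
      have hm : (m : ℝ≥0∞) < ENNReal.ofReal |A.det| := by
        rw [ENNReal.ofReal, ENNReal.coe_lt_coe]
        exact (Real.toNNReal_lt_toNNReal_iff hpos).2 (half_lt_self hpos)
      obtain ⟨δ, hδ, hδ0⟩ :=
        ((mul_le_addHaar_image_of_lt_det μ A hm).and self_mem_nhdsWithin).exists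
      have hδpos : 0 < δ := hδ0
      refine ⟨δ, hδpos.ne', fun _ t ht ht0 => ?_⟩
      have := hδ t f ht
      rw [ht0] at this
      rcases mul_eq_zero.1 (nonpos_iff_eq_zero.1 this) with h | h
      · exact absurd h (by exact_mod_cast hm0.ne')
      · exact h
  choose r hr0 hr using hex
  obtain ⟨t, A, -, -, hcov, happ, hA⟩ := exists_partition_approximatesLinearOn_of_hasFDerivWithinAt
    f S f' (fun x hx => (hf' x hx.1).mono hSs) r hr0
  have : S ⊆ ⋃ n, S ∩ t n := by
    rw [← inter_iUnion]; exact subset_inter subset_rfl hcov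
  refine measure_mono_null this (measure_iUnion_null fun n => ?_)
  obtain ⟨y, hy, hAy⟩ := hA hne n
  refine hr (A n) (hAy ▸ hy.2) _ (happ n) (measure_mono_null (image_mono ?_) h)
  exact inter_subset_left.trans hSs

/-- A family of functionals on `ℝᵏ`, any `k` of which are linearly dependent, has a common
nonzero kernel vector. -/
theorem exists_ne_zero_forall_apply_eq_zero {k : ℕ} {ι : Type*}
    (φ : ι → EuclideanSpace ℝ (Fin k) →L[ℝ] ℝ)
    (h : ∀ i : Fin k → ι, (((EuclideanSpace.equiv (Fin k) ℝ).symm :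
      (Fin k → ℝ) →L[ℝ] EuclideanSpace ℝ (Fin k)) ∘L
        ContinuousLinearMap.pi fun j => φ (i j)).det = 0) :
    ∃ v, v ≠ 0 ∧ ∀ i, φ i v = 0 := by
  by_contra! hcon
  -- With trivial common kernel the functionals span the dual, so `k` of them form a basis. The
  -- vanishing determinant gives a nonzero vector killed by this basis, hence by every functional.
  have hker : ⨅ i, LinearMap.ker (φ i : EuclideanSpace ℝ (Fin k) →ₗ[ℝ] ℝ) = ⊥ := by
    rw [eq_bot_iff]
    intro v hv
    by_contra hv0
    obtain ⟨i, hi⟩ := hcon v hv0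
    exact hi ((Submodule.mem_iInf _).1 hv i)
  set ψ : ι → Module.Dual ℝ (EuclideanSpace ℝ (Fin k)) := fun i => (φ i).toLinearMap with hψ
  have hspan : Submodule.span ℝ (range ψ) = ⊤ := by
    rw [eq_top_iff]
    intro K _
    exact FiniteDimensional.mem_span_of_iInf_ker_le_ker (hker.le.trans bot_le)
  obtain ⟨κ, a, -, hsp, hli⟩ := exists_linearIndependent' ℝ ψ
  rw [hspan] at hsp
  let b := Module.Basis.mk hli hsp.ge
  have : Finite κ := Module.Finite.finite_basis b
  have := Fintype.ofFinite κ
  have hcard : Fintype.card κ = k := by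
    rw [← Module.finrank_eq_card_basis b, Subspace.dual_finrank_eq, finrank_euclideanSpace_fin]
  let e : Fin k ≃ κ := (Fintype.equivFinOfCardEq hcard).symm
  set T := (((EuclideanSpace.equiv (Fin k) ℝ).symm :
      (Fin k → ℝ) →L[ℝ] EuclideanSpace ℝ (Fin k)) ∘L
        ContinuousLinearMap.pi fun j => φ (a (e j))) with hT
  have hdet : LinearMap.det (T : EuclideanSpace ℝ (Fin k) →ₗ[ℝ] EuclideanSpace ℝ (Fin k)) = 0 :=
    h (a ∘ e)
  have := LinearMap.bot_lt_ker_of_det_eq_zero hdet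
  obtain ⟨v, hv, hv0⟩ := Submodule.exists_mem_ne_zero_of_ne_bot this.ne'
  have hTv : T v = 0 := hv
  have hφ : ∀ j, φ (a (e j)) v = 0 := by
    intro j
    have := congrArg (EuclideanSpace.equiv (Fin k) ℝ) hTv
    simpa [hT] using congrFun this j
  obtain ⟨i, hi⟩ := hcon v hv0
  apply hi
  have hmem : ψ i ∈ Submodule.span ℝ (range (ψ ∘ a)) := by rw [hsp]; trivial
  have hle : Submodule.span ℝ (range (ψ ∘ a)) ≤
      LinearMap.ker (Module.Dual.eval ℝ (EuclideanSpace ℝ (Fin k)) v) := by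
    rw [Submodule.span_le]
    rintro _ ⟨c, rfl⟩
    have := hφ (e.symm c)
    rw [e.apply_symm_apply] at this
    simpa [hψ] using this
  simpa [hψ] using hle hmem

/-- Lets ball scaling, determinant formulas, density and Rademacher be applied to `μH[k]` itself,
with no normalizing constant against Lebesgue measure. -/
instance isAddHaarMeasure_hausdorffMeasure_euclideanSpace (k : ℕ) :
    (μH[(k : ℝ)] : Measure (EuclideanSpace ℝ (Fin k))).IsAddHaarMeasure := by
  simpa using MeasureTheory.isAddHaarMeasure_hausdorffMeasure (E := EuclideanSpace ℝ (Fin k))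

/-- If `g(E)` is `k`-null, then at almost every point of `E ⊆ ℝᵏ` the derivatives of all the
functions `dist (g ·) (y i)` have a common nonzero kernel vector. -/
theorem hausdorffMeasure_forall_exists_fderiv_ne_zero_eq_zero {k : ℕ} {ι Y : Type*} [Countable ι]
    [MetricSpace Y] [MeasurableSpace Y] [BorelSpace Y] {E : Set (EuclideanSpace ℝ (Fin k))}
    {g : EuclideanSpace ℝ (Fin k) → Y} {y : ι → Y} {G : ι → EuclideanSpace ℝ (Fin k) → ℝ}
    (hGd : ∀ i, ∀ x ∈ E, DifferentiableAt ℝ (G i) x)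
    (hGE : ∀ i, ∀ x ∈ E, G i x = dist (g x) (y i)) (h0 : μH[(k : ℝ)] (g '' E) = 0) :
    μH[(k : ℝ)] {x ∈ E | ¬ ∃ v, v ≠ 0 ∧ ∀ i, fderiv ℝ (G i) x v = 0} = 0 := by
  set J := (EuclideanSpace.equiv (Fin k) ℝ).symm with hJ
  have key : ∀ i : Fin k → ι, μH[(k : ℝ)] {x ∈ E | ((J : (Fin k → ℝ) →L[ℝ] EuclideanSpace ℝ (Fin k))
      ∘L ContinuousLinearMap.pi fun j => fderiv ℝ (G (i j)) x).det ≠ 0} = 0 := by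
    intro i
    refine addHaar_det_ne_zero_eq_zero_of_addHaar_image_eq_zero _
      (f := fun x => J fun j => G (i j) x) (fun x hx => ?_) ?_
    · refine HasFDerivAt.hasFDerivWithinAt ?_
      refine HasFDerivAt.comp x (J : (Fin k → ℝ) →L[ℝ] EuclideanSpace ℝ (Fin k)).hasFDerivAt ?_
      exact hasFDerivAt_pi.2 fun j => (hGd (i j) x hx).hasFDerivAt
    · have himg : (fun x => J fun j => G (i j) x) '' E
          = (fun z : Y => J fun j => dist z (y (i j))) '' (g '' E) := by
        rw [image_image]
        exact image_congr fun x hx => by simp only [hGE _ x hx]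
      have hlip : LipschitzWith (‖(J : (Fin k → ℝ) →L[ℝ] EuclideanSpace ℝ (Fin k))‖₊ * 1)
          (fun z : Y => J fun j => dist z (y (i j))) :=
        (J : (Fin k → ℝ) →L[ℝ] EuclideanSpace ℝ (Fin k)).lipschitz.comp
          (LipschitzWith.of_dist_le_mul fun z z' => by
            rw [NNReal.coe_one, one_mul, dist_pi_le_iff dist_nonneg]
            intro j
            rw [Real.dist_eq]
            exact abs_dist_sub_le z z' _)
      rw [himg]
      have := hlip.hausdorffMeasure_image_le (Nat.cast_nonneg k) (g '' E)
      rw [h0, mul_zero] at this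
      exact nonpos_iff_eq_zero.1 this
  -- There are only countably many `k`-tuples of indices, so all their Jacobians vanish off one null
  -- set.
  refine measure_mono_null ?_ (measure_iUnion_null key)
  rintro x ⟨hx, hxn⟩
  by_contra hcon
  simp only [mem_iUnion, mem_ofPred_eq, not_exists, not_and, not_not] at hcon
  exact hxn (exists_ne_zero_forall_apply_eq_zero _ fun i => hcon i hx)

/-! ### Lines near density points -/

/-- Among the segments `s ↦ y + w + s • v` with `‖w‖ < ρ`, one meets the complement of `B` in a
set of small length, provided this complement has small measure. -/
theorem exists_segment_volume_diff_le {V : Type*} [NormedAddCommGroup V] [NormedSpace ℝ V]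
    [FiniteDimensional ℝ V] [MeasurableSpace V] [BorelSpace V] (μ : Measure V)
    [μ.IsAddHaarMeasure] {B S : Set V} (hB : MeasurableSet B) {y v : V} {ρ T : ℝ} {η : ℝ≥0∞}
    (hS : ∀ w ∈ Metric.ball (0 : V) ρ, ∀ s ∈ Ioc 0 T, y + w + s • v ∈ S)
    (hlt : ENNReal.ofReal T * μ (S \ B) < η * μ (Metric.ball 0 ρ)) :
    ∃ w ∈ Metric.ball (0 : V) ρ, volume (Ioc 0 T \ {s : ℝ | y + w + s • v ∈ B}) ≤ η := by
  by_contra! hcon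
  -- If every translated segment missed `B` in length more than `η`, integrating over `w` and
  -- swapping the integrals would give `η * μ(ball) ≤ T * μ(S \ B)`; for fixed `s` the inner
  -- integral is bounded by translation invariance.
  refine absurd hlt (not_lt.2 ?_)
  set φ : V → ℝ → ℝ≥0∞ := fun w s => Bᶜ.indicator 1 (y + w + s • v) with hφ
  have hmeas : Measurable (Function.uncurry φ) := by
    refine (measurable_one.indicator hB.compl).comp ?_
    fun_prop
  have h1 : ∀ w, ∫⁻ s in Ioc 0 T, φ w s = volume (Ioc 0 T \ {s : ℝ | y + w + s • v ∈ B}) := by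
    intro w
    have hm : MeasurableSet {s : ℝ | y + w + s • v ∈ B} :=
      hB.preimage (by fun_prop : Measurable fun s : ℝ => y + w + s • v)
    have : φ w = ({s : ℝ | y + w + s • v ∈ B}ᶜ).indicator 1 := by
      ext s; by_cases hs : y + w + s • v ∈ B <;> simp [hφ, hs]
    rw [this, lintegral_indicator_one hm.compl, Measure.restrict_apply hm.compl, inter_comm,
      Set.sdiff_eq]
  calc η * μ (Metric.ball 0 ρ) = ∫⁻ _ in Metric.ball (0 : V) ρ, η ∂μ := by simp
    _ ≤ ∫⁻ w in Metric.ball (0 : V) ρ, (∫⁻ s in Ioc 0 T, φ w s) ∂μ := by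
        refine setLIntegral_mono' Metric.isOpen_ball.measurableSet fun w hw => ?_
        rw [h1]; exact (hcon w hw).le
    _ = ∫⁻ s in Ioc 0 T, ∫⁻ w in Metric.ball (0 : V) ρ, φ w s ∂μ :=
        lintegral_lintegral_swap hmeas.aemeasurable
    _ ≤ ∫⁻ _ in Ioc 0 T, μ (S \ B) := by
        refine setLIntegral_mono' measurableSet_Ioc fun s hs => ?_
        have hm : MeasurableSet {w : V | y + w + s • v ∈ B} :=
          hB.preimage (by fun_prop : Measurable fun w : V => y + w + s • v)
        have : (fun w => φ w s) = ({w : V | y + w + s • v ∈ B}ᶜ).indicator 1 := by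
          ext w; by_cases hw : y + w + s • v ∈ B <;> simp [hφ, hw]
        rw [this, lintegral_indicator_one hm.compl, Measure.restrict_apply hm.compl,
          ← measure_preimage_add μ (y + s • v) (S \ B)]
        refine measure_mono fun w hw => ?_
        have e : y + s • v + w = y + w + s • v := by abel
        simp only [mem_preimage, e]
        exact ⟨hS w hw.2 s hs, hw.1⟩
    _ = ENNReal.ofReal T * μ (S \ B) := by simp [mul_comm]

/-- The local estimate at density points: a Lipschitz map that moves little along lines in
direction `v` contained in `B` moves little in direction `v` near density points of `B`. -/
theorem exists_dist_le_of_tendsto_density {V X : Type*} [NormedAddCommGroup V]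
    [InnerProductSpace ℝ V] [FiniteDimensional ℝ V] [MeasurableSpace V] [BorelSpace V]
    (μ : Measure V) [μ.IsAddHaarMeasure] [MetricSpace X] {B : Set V} (hB : MeasurableSet B)
    {f : V → X} {L D : ℝ≥0} (hf : LipschitzOnWith L f B) {v : V} (hv : ‖v‖ = 1) {ε : ℝ}
    (hε : 0 < ε) (hε1 : ε ≤ 1)
    (hline : ∀ (p : V) (a b : ℝ), a ≤ b → p + a • v ∈ B → p + b • v ∈ B →
      dist (f (p + a • v)) (f (p + b • v)) ≤
        D * (ε * (b - a) + volume.real (Ioc a b \ {s : ℝ | p + s • v ∈ B})))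
    {x : V} (hx : x ∈ B)
    (hdens : Tendsto (fun r => μ (Bᶜ ∩ Metric.closedBall x r) / μ (Metric.closedBall x r))
      (𝓝[>] 0) (𝓝 0)) :
    ∃ r > 0, ∀ z ∈ B, dist z x < r → dist (f x) (f z) ≤
      (6 * L + 2 * D) * (ε * ‖z - x‖ + ‖(z - x) - inner ℝ v (z - x) • v‖) := by
  set n := Module.finrank ℝ V
  -- Chosen so that `r * c * μ(ball of radius 2r) = ε r * μ(ball of radius ε r)`, the threshold in
  -- the Fubini argument.
  set c : ℝ := ε * (ε / 2) ^ n with hc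
  have hc0 : 0 < c := by positivity
  have hev := hdens.eventually (gt_mem_nhds (ENNReal.ofReal_pos.2 hc0))
  rw [eventually_nhdsWithin_iff, Metric.eventually_nhds_iff] at hev
  obtain ⟨δ, hδ, hev⟩ := hev
  refine ⟨δ / 2, half_pos hδ, fun z hz hzx => ?_⟩
  set u := z - x with hu
  set r := ‖u‖ with hr
  set P := ‖u - inner ℝ v u • v‖ with hP
  have hP0 : 0 ≤ P := norm_nonneg _
  have hL0 : (0 : ℝ) ≤ L := L.2
  have hD0 : (0 : ℝ) ≤ D := D.2
  have hzr : dist z x = r := by rw [dist_eq_norm]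
  rcases (norm_nonneg u).eq_or_lt with h0 | hr0
  · have : z = x := by rw [← sub_eq_zero]; exact norm_eq_zero.1 h0.symm
    rw [this, dist_self]; positivity
  have hεr : 0 < ε * r := mul_pos hε hr0
  have hεr' : ε * r ≤ r := mul_le_of_le_one_left hr0.le hε1
  set t := inner ℝ v u with ht
  have htr : |t| ≤ r := by
    have := abs_real_inner_le_norm v u
    rwa [hv, one_mul] at this
  have hxt : dist z (x + t • v) = P := by
    rw [dist_eq_norm, hP, hu]; congr 1; abel
  have hrt : r ≤ P + |t| := by
    have : u = (u - t • v) + t • v := by abel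
    calc r = ‖(u - t • v) + t • v‖ := by rw [← this]
      _ ≤ _ := norm_add_le _ _
      _ = P + |t| := by rw [norm_smul, hv, mul_one, Real.norm_eq_abs]
  -- A short component along `v` is absorbed by the plain Lipschitz bound. A long one leaves room
  -- for a window of length `2 ε r` at each end of the segment.
  rcases lt_or_ge |t| (4 * (ε * r)) with hsmall | hbig
  · have h1 := hf.dist_le_mul x hx z hz
    rw [dist_comm x z, hzr] at h1
    have h2 : (L : ℝ) * r ≤ L * (P + 4 * (ε * r)) := by gcongr; linarith
    nlinarith [mul_nonneg hL0 hP0, mul_nonneg hD0 hP0, mul_nonneg hL0 hεr.le,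
      mul_nonneg hD0 hεr.le]
  -- the segment from `y` to `y + |t| • v` joins `x` and `x + t • v`, in one of the two orders
  set y := x + min t 0 • v with hy
  have hy_cases : (y = x ∧ y + |t| • v = x + t • v) ∨ (y = x + t • v ∧ y + |t| • v = x) := by
    rcases le_total 0 t with h | h
    · left; simp [hy, min_eq_right h, abs_of_nonneg h]
    · right; simp [hy, min_eq_left h, abs_of_nonpos h]
  have hball : ENNReal.ofReal |t| * μ (Metric.closedBall x (2 * r) \ B)
      < ENNReal.ofReal (ε * r) * μ (Metric.ball 0 (ε * r)) := by
    have h2r : 0 < 2 * r := by positivity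
    have h1 := hev (y := 2 * r) (by
      rw [Real.dist_eq, sub_zero, abs_of_pos h2r]; linarith) h2r
    have hpos : μ (Metric.closedBall x (2 * r)) ≠ 0 := (Metric.measure_closedBall_pos μ x h2r).ne'
    have hfin : μ (Metric.closedBall x (2 * r)) ≠ ∞ := measure_closedBall_lt_top.ne
    rw [ENNReal.div_lt_iff (Or.inl hpos) (Or.inl hfin)] at h1
    have h3 : Metric.closedBall x (2 * r) \ B = Bᶜ ∩ Metric.closedBall x (2 * r) := by
      rw [sdiff_eq, inter_comm]
    have h4 : μ (Metric.ball 0 (ε * r))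
        = ENNReal.ofReal ((ε / 2) ^ n) * μ (Metric.closedBall x (2 * r)) := by
      rw [Measure.addHaar_ball_of_pos μ _ hεr, Measure.addHaar_closedBall μ _ h2r.le, ← mul_assoc,
        ← ENNReal.ofReal_mul (by positivity), ← mul_pow]
      congr 3; ring
    rw [h3, h4]
    calc ENNReal.ofReal |t| * μ (Bᶜ ∩ Metric.closedBall x (2 * r))
        ≤ ENNReal.ofReal r * μ (Bᶜ ∩ Metric.closedBall x (2 * r)) := by gcongr
      _ < ENNReal.ofReal r * (ENNReal.ofReal c * μ (Metric.closedBall x (2 * r))) :=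
          ENNReal.mul_lt_mul_right (ENNReal.ofReal_pos.2 hr0).ne' ENNReal.ofReal_ne_top h1
      _ = ENNReal.ofReal (ε * r) *
          (ENNReal.ofReal ((ε / 2) ^ n) * μ (Metric.closedBall x (2 * r))) := by
        rw [← mul_assoc, ← mul_assoc, ← ENNReal.ofReal_mul hr0.le, ← ENNReal.ofReal_mul hεr.le]
        congr 2; rw [hc]; ring
  obtain ⟨w, hw, hvol⟩ := exists_segment_volume_diff_le μ hB (y := y) (v := v) (ρ := ε * r)
    (T := |t|) (η := ENNReal.ofReal (ε * r)) (S := Metric.closedBall x (2 * r)) (by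
      intro w hw s hs
      rw [mem_ball_zero_iff] at hw
      rw [Metric.mem_closedBall, dist_eq_norm]
      have e : y + w + s • v - x = w + (min t 0 + s) • v := by rw [hy, add_smul]; abel
      rw [e]
      refine (norm_add_le _ _).trans ?_
      rw [norm_smul, hv, mul_one, Real.norm_eq_abs]
      have : |min t 0 + s| ≤ |t| := by
        rcases le_total 0 t with h | h
        · rw [min_eq_right h, zero_add, abs_of_pos hs.1]; exact hs.2
        · rw [min_eq_left h, abs_of_nonpos h]
          have := hs.2; rw [abs_of_nonpos h] at this
          exact abs_le.2 ⟨by linarith [hs.1], by linarith⟩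
      linarith) hball
  rw [mem_ball_zero_iff] at hw
  set F := {s : ℝ | y + w + s • v ∈ B} with hF
  set T := |t|
  have hfinT : ∀ a b : ℝ, volume (Ioc a b \ F) ≠ ∞ := fun a b =>
    ((measure_mono sdiff_subset).trans_lt (by simp)).ne
  have hvolr : volume.real (Ioc 0 T \ F) ≤ ε * r :=
    ENNReal.toReal_le_of_le_ofReal hεr.le hvol
  -- A window of length `2 ε r` cannot avoid `F`, whose complement in the segment has length at most
  -- `ε r`.
  have hpick : ∀ a, 0 ≤ a → a + 2 * (ε * r) ≤ T → ∃ s ∈ F, s ∈ Ioc a (a + 2 * (ε * r)) := by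
    intro a ha haT
    by_contra! hno
    have hsub : Ioc a (a + 2 * (ε * r)) ⊆ Ioc 0 T \ F := fun s hs =>
      ⟨⟨ha.trans_lt hs.1, hs.2.trans haT⟩, fun hsF => hno s hsF hs⟩
    have := measureReal_mono hsub (hfinT _ _)
    rw [Real.volume_real_Ioc_of_le (by linarith)] at this
    linarith
  obtain ⟨s₀, hs₀F, hs₀⟩ := hpick 0 le_rfl (by linarith)
  obtain ⟨s₁, hs₁F, hs₁⟩ := hpick (T - 2 * (ε * r)) (by linarith) (by linarith)
  rw [zero_add] at hs₀
  rw [sub_add_cancel] at hs₁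
  have h01 : s₀ ≤ s₁ := by linarith [hs₀.2, hs₁.1]
  have hmid := hline (y + w) s₀ s₁ h01 hs₀F hs₁F
  have hvol' : volume.real (Ioc s₀ s₁ \ F) ≤ ε * r :=
    (measureReal_mono (sdiff_subset_sdiff_left (Ioc_subset_Ioc hs₀.1.le hs₁.2))
      (hfinT _ _)).trans hvolr
  have hmid' : dist (f (y + w + s₀ • v)) (f (y + w + s₁ • v)) ≤ D * (2 * (ε * r)) := by
    refine hmid.trans (mul_le_mul_of_nonneg_left ?_ hD0)
    have : ε * (s₁ - s₀) ≤ ε * r := by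
      gcongr; linarith [hs₀.1, hs₁.2]
    linarith
  have hend₀ : dist y (y + w + s₀ • v) ≤ 3 * (ε * r) := by
    rw [dist_comm, dist_eq_norm]
    have e : y + w + s₀ • v - y = w + s₀ • v := by abel
    rw [e]
    refine (norm_add_le _ _).trans ?_
    rw [norm_smul, hv, mul_one, Real.norm_eq_abs, abs_of_pos hs₀.1]
    linarith [hs₀.2]
  have hend₁ : dist (y + T • v) (y + w + s₁ • v) ≤ 3 * (ε * r) := by
    rw [dist_comm, dist_eq_norm]
    have e : y + w + s₁ • v - (y + T • v) = w + (s₁ - T) • v := by rw [sub_smul]; abel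
    rw [e]
    refine (norm_add_le _ _).trans ?_
    rw [norm_smul, hv, mul_one, Real.norm_eq_abs, abs_of_nonpos (by linarith [hs₁.2])]
    linarith [hs₁.1]
  -- The chain `x, p, q, z` costs `3 L ε r`, `2 D ε r` and `L (3 ε r + P)`.
  have hfin : ∀ p q, p ∈ B → q ∈ B → dist (f p) (f q) ≤ D * (2 * (ε * r)) →
      dist x p ≤ 3 * (ε * r) → dist (x + t • v) q ≤ 3 * (ε * r) → dist (f x) (f z) ≤
        (6 * L + 2 * D) * (ε * r + P) := by
    intro p q hp hq hpq hxp hzq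
    have h1 := (hf.dist_le_mul x hx p hp).trans (mul_le_mul_of_nonneg_left hxp hL0)
    have h2 : dist q z ≤ 3 * (ε * r) + P := by
      rw [dist_comm]
      linarith [dist_triangle z (x + t • v) q]
    have h3 := (hf.dist_le_mul q hq z hz).trans (mul_le_mul_of_nonneg_left h2 hL0)
    have h4 := dist_triangle4 (f x) (f p) (f q) (f z)
    nlinarith [mul_nonneg hL0 hP0, mul_nonneg hD0 hP0]
  rcases hy_cases with ⟨e0, e1⟩ | ⟨e0, e1⟩
  · exact hfin _ _ hs₀F hs₁F hmid' (e0 ▸ hend₀) (e1 ▸ hend₁)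
  · refine hfin _ _ hs₁F hs₀F (by rwa [dist_comm]) ?_ ?_
    · rw [e1] at hend₁; exact hend₁
    · rw [← e0]; exact hend₀

/-! ### From anisotropic estimates to Hausdorff measure -/

/-- Lipschitz control by a linear map `T` bounds the Hausdorff measure of an image by `|det T|`. -/
theorem hausdorffMeasure_image_le_of_dist_le_linearMap {k : ℕ} {X : Type*} [MetricSpace X]
    [MeasurableSpace X] [BorelSpace X] {f : EuclideanSpace ℝ (Fin k) → X}
    {A : Set (EuclideanSpace ℝ (Fin k))}
    (T : EuclideanSpace ℝ (Fin k) →ₗ[ℝ] EuclideanSpace ℝ (Fin k)) {K : ℝ≥0}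
    (h : ∀ x ∈ A, ∀ z ∈ A, dist (f x) (f z) ≤ K * dist (T x) (T z)) :
    μH[(k : ℝ)] (f '' A) ≤
      (K : ℝ≥0∞) ^ (k : ℝ) * (ENNReal.ofReal |LinearMap.det T| * μH[(k : ℝ)] A) := by
  -- `T` need not be injective, but `f` is constant on its fibres in `A`, so `f` factors through `T`
  -- by a `K`-Lipschitz map.
  set g := f ∘ Function.invFunOn T A with hg
  have hinv : ∀ x ∈ A, Function.invFunOn T A (T x) ∈ A ∧ T (Function.invFunOn T A (T x)) = T x :=
    fun x hx => Function.invFunOn_pos ⟨x, hx, rfl⟩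
  have hgT : ∀ x ∈ A, g (T x) = f x := by
    intro x hx
    have := h _ (hinv x hx).1 x hx
    rw [(hinv x hx).2, dist_self, mul_zero] at this
    exact dist_le_zero.1 this
  have hlip : LipschitzOnWith K g (T '' A) := by
    refine LipschitzOnWith.of_dist_le_mul ?_
    rintro _ ⟨x, hx, rfl⟩ _ ⟨z, hz, rfl⟩
    rw [hgT x hx, hgT z hz]
    exact h x hx z hz
  have himg : f '' A = g '' (T '' A) := by
    rw [image_image]; exact image_congr fun x hx => (hgT x hx).symm
  rw [himg, ← Measure.addHaar_image_linearMap]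
  exact hlip.hausdorffMeasure_image_le (Nat.cast_nonneg k)

/-- The anisotropic local estimate `dist (f x) (f z) ≤ C (ε |z - x| + |P_v (z - x)|)` bounds the
Hausdorff measure of the image by a multiple of `ε`. -/
theorem hausdorffMeasure_image_le_of_local_dist_le {k : ℕ} {X : Type*} [MetricSpace X]
    [MeasurableSpace X] [BorelSpace X] {f : EuclideanSpace ℝ (Fin k) → X}
    {A : Set (EuclideanSpace ℝ (Fin k))} {v : EuclideanSpace ℝ (Fin k)} (hv : ‖v‖ = 1) {ε : ℝ}
    (hε : 0 < ε) (hε1 : ε ≤ 1) {C : ℝ≥0}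
    (h : ∀ x ∈ A, ∃ r > 0, ∀ z ∈ A, dist z x < r →
      dist (f x) (f z) ≤ C * (ε * ‖z - x‖ + ‖(z - x) - inner ℝ v (z - x) • v‖)) :
    μH[(k : ℝ)] (f '' A) ≤
      ((5 * C : ℝ≥0) : ℝ≥0∞) ^ (k : ℝ) * (ENNReal.ofReal ε * μH[(k : ℝ)] A) := by
  -- `T` scales `v` by `ε` and fixes its orthogonal complement.
  set T : EuclideanSpace ℝ (Fin k) →ₗ[ℝ] EuclideanSpace ℝ (Fin k) :=
    LinearMap.transvection (innerₗ (EuclideanSpace ℝ (Fin k)) v) ((ε - 1) • v) with hT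
  have hTapp : ∀ u, T u = (u - inner ℝ v u • v) + (ε * inner ℝ v u) • v := by
    intro u
    simp only [hT, LinearMap.transvection.apply, innerₗ_apply_apply]
    module
  have hdet : LinearMap.det T = ε := by
    rw [hT, LinearMap.transvection.det]
    simp [hv]
  have hvv : inner ℝ v v = (1 : ℝ) := by simp [hv]
  have hTle : ∀ u : EuclideanSpace ℝ (Fin k), ε * ‖u‖ + ‖u - inner ℝ v u • v‖ ≤ 5 * ‖T u‖ := by
    intro u
    set t := inner ℝ v u with ht
    have h1 : ε * |t| ≤ ‖T u‖ := by
      have e : inner ℝ v (T u) = ε * t := by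
        rw [hTapp, inner_add_right, inner_sub_right, inner_smul_right, inner_smul_right, hvv, ← ht]
        ring
      have := abs_real_inner_le_norm v (T u)
      rwa [hv, one_mul, e, abs_mul, abs_of_pos hε] at this
    have h2 : ‖u - t • v‖ ≤ ‖T u‖ + ε * |t| := by
      have e : u - t • v = T u - (ε * t) • v := by rw [hTapp]; abel
      rw [e]
      refine (norm_sub_le _ _).trans_eq ?_
      rw [norm_smul, hv, mul_one, Real.norm_eq_abs, abs_mul, abs_of_pos hε]
    have h3 : ‖u‖ ≤ ‖u - t • v‖ + |t| := by
      calc ‖u‖ = ‖(u - t • v) + t • v‖ := by congr 1; abel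
        _ ≤ _ := norm_add_le _ _
        _ = _ := by rw [norm_smul, hv, mul_one, Real.norm_eq_abs]
    have h4 : ε * ‖u‖ ≤ ‖u - t • v‖ + ε * |t| := by
      have := mul_le_mul_of_nonneg_left h3 hε.le
      have h5 : ε * ‖u - t • v‖ ≤ ‖u - t • v‖ := mul_le_of_le_one_left (norm_nonneg _) hε1
      linarith
    linarith
  set c : ℝ≥0∞ := ((5 * C : ℝ≥0) : ℝ≥0∞) ^ (k : ℝ) * ENNReal.ofReal ε with hc
  -- On `An n` the estimate holds at the uniform scale `1 / (n + 1)`, hence globally on pieces of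
  -- smaller diameter.
  set An : ℕ → Set (EuclideanSpace ℝ (Fin k)) := fun n =>
    {x ∈ A | ∀ z ∈ A, dist z x < 1 / ((n : ℝ) + 1) →
      dist (f x) (f z) ≤ C * (ε * ‖z - x‖ + ‖(z - x) - inner ℝ v (z - x) • v‖)} with hAn
  have hAnA : ∀ n, An n ⊆ A := fun n x hx => hx.1
  have hmono : Monotone An := by
    intro m n hmn x hx
    refine ⟨hx.1, fun z hz hzx => hx.2 z hz (hzx.trans_le ?_)⟩
    exact one_div_le_one_div_of_le (by positivity) (by gcongr)
  have hUn : A = ⋃ n, An n := by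
    refine Subset.antisymm (fun x hx => ?_) (iUnion_subset hAnA)
    obtain ⟨r, hr, hx'⟩ := h x hx
    obtain ⟨n, hn⟩ := exists_nat_one_div_lt hr
    exact mem_iUnion.2 ⟨n, hx, fun z hz hzx => hx' z hz (hzx.trans hn)⟩
  have hpiece : ∀ n : ℕ, ∀ S : Set (EuclideanSpace ℝ (Fin k)),
      (∀ x ∈ S, ∀ z ∈ S, dist z x < 1 / ((n : ℝ) + 1)) →
      μH[(k : ℝ)] (f '' (An n ∩ S)) ≤ c * μH[(k : ℝ)] (An n ∩ S) := by
    intro n S hS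
    have := hausdorffMeasure_image_le_of_dist_le_linearMap (f := f) (A := An n ∩ S) T
      (K := 5 * C) (by
        intro x hx z hz
        refine (hx.1.2 z hz.1.1 (hS x hx.2 z hz.2)).trans ?_
        rw [dist_comm, dist_eq_norm, ← map_sub]
        push_cast
        calc (C : ℝ) * _ ≤ C * (5 * ‖T (z - x)‖) := by gcongr; exact hTle _
          _ = 5 * C * ‖T (z - x)‖ := by ring)
    rwa [hdet, abs_of_pos hε, ← mul_assoc] at this
  have hbound : ∀ n, μH[(k : ℝ)] (f '' An n) ≤ c * μH[(k : ℝ)] A := by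
    intro n
    set ρ : ℝ := 1 / ((n : ℝ) + 1) / 2 with hρ
    have hρ0 : 0 < ρ := by positivity
    -- `An n` need not be measurable; the cutting pieces are, which is enough to add up the measures
    -- of the intersections.
    set S : ℕ → Set (EuclideanSpace ℝ (Fin k)) :=
      disjointed fun j => Metric.ball (TopologicalSpace.denseSeq (EuclideanSpace ℝ (Fin k)) j) ρ
      with hS
    have hSm : ∀ j, MeasurableSet (S j) :=
      MeasurableSet.disjointed fun j => Metric.isOpen_ball.measurableSet
    have hSU : ⋃ j, S j = univ := by
      rw [hS, iUnion_disjointed, eq_univ_iff_forall]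
      intro x
      obtain ⟨_, hy, j, rfl⟩ := Metric.dense_iff.1 
        (TopologicalSpace.denseRange_denseSeq (EuclideanSpace ℝ (Fin k))) x ρ hρ0
      exact mem_iUnion.2 ⟨j, by rwa [Metric.mem_ball, dist_comm]⟩
    have hSd : ∀ j, ∀ x ∈ S j, ∀ z ∈ S j, dist z x < 1 / ((n : ℝ) + 1) := by
      intro j x hx z hz
      have h1 := Metric.mem_ball.1 (disjointed_subset _ j hx)
      have h2 := Metric.mem_ball.1 (disjointed_subset _ j hz)
      have := dist_triangle_right z x (TopologicalSpace.denseSeq (EuclideanSpace ℝ (Fin k)) j)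
      linarith
    calc μH[(k : ℝ)] (f '' An n) = μH[(k : ℝ)] (⋃ j, f '' (An n ∩ S j)) := by
          rw [← image_iUnion, ← inter_iUnion, hSU, inter_univ]
      _ ≤ ∑' j, μH[(k : ℝ)] (f '' (An n ∩ S j)) := measure_iUnion_le _
      _ ≤ ∑' j, c * μH[(k : ℝ)] (An n ∩ S j) :=
          ENNReal.tsum_le_tsum fun j => hpiece n (S j) (hSd j)
      _ = c * ∑' j, (μH[(k : ℝ)] : Measure (EuclideanSpace ℝ (Fin k))).restrict (An n) (S j) := by
          rw [ENNReal.tsum_mul_left]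
          congr 2; ext j
          rw [Measure.restrict_apply (hSm j), inter_comm]
      _ = c * (μH[(k : ℝ)] : Measure (EuclideanSpace ℝ (Fin k))).restrict (An n) (⋃ j, S j) := by
          rw [measure_iUnion (disjoint_disjointed _) hSm]
      _ = c * μH[(k : ℝ)] (An n) := by rw [hSU, Measure.restrict_apply_univ]
      _ ≤ c * μH[(k : ℝ)] A := by gcongr; exact hAnA n
  rw [← mul_assoc, hUn, image_iUnion,
    (show Monotone fun n => f '' An n from fun m n hmn => image_mono (hmono hmn)).measure_iUnion,
    ← hUn]
  exact iSup_le hbound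

/-- A Lipschitz map that moves little along lines in direction `v` inside `B` has an image of small
Hausdorff measure. -/
theorem hausdorffMeasure_image_le_of_line_dist_le {k : ℕ} {X : Type*} [MetricSpace X]
    [MeasurableSpace X] [BorelSpace X] {f : EuclideanSpace ℝ (Fin k) → X}
    {B : Set (EuclideanSpace ℝ (Fin k))} (hB : MeasurableSet B) {L D : ℝ≥0}
    (hf : LipschitzOnWith L f B) {v : EuclideanSpace ℝ (Fin k)} (hv : ‖v‖ = 1) {ε : ℝ}
    (hε : 0 < ε) (hε1 : ε ≤ 1)
    (hline : ∀ (p : EuclideanSpace ℝ (Fin k)) (a b : ℝ), a ≤ b → p + a • v ∈ B → p + b • v ∈ B →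
      dist (f (p + a • v)) (f (p + b • v)) ≤
        D * (ε * (b - a) + volume.real (Ioc a b \ {s : ℝ | p + s • v ∈ B}))) :
    μH[(k : ℝ)] (f '' B) ≤
      ((5 * (6 * L + 2 * D) : ℝ≥0) : ℝ≥0∞) ^ (k : ℝ) * (ENNReal.ofReal ε * μH[(k : ℝ)] B) := by
  set μ : Measure (EuclideanSpace ℝ (Fin k)) := μH[(k : ℝ)]
  set N := {x | ¬ Tendsto (fun r => μ (Bᶜ ∩ Metric.closedBall x r) / μ (Metric.closedBall x r))
      (𝓝[>] 0) (𝓝 (Bᶜ.indicator 1 x))}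
  have hN : μ N = 0 := Besicovitch.ae_tendsto_measure_inter_div_of_measurableSet μ hB.compl
  have hnull : μH[(k : ℝ)] (f '' (B ∩ N)) = 0 := by
    have := (hf.mono (inter_subset_left (t := N))).hausdorffMeasure_image_le (Nat.cast_nonneg k)
    rw [measure_mono_null inter_subset_right hN, mul_zero] at this
    exact nonpos_iff_eq_zero.1 this
  have hmain := hausdorffMeasure_image_le_of_local_dist_le (f := f) (A := B \ N) hv hε hε1
    (C := 6 * L + 2 * D) (by
      intro x hx
      have hdens : Tendsto (fun r => μ (Bᶜ ∩ Metric.closedBall x r) / μ (Metric.closedBall x r))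
          (𝓝[>] 0) (𝓝 0) := by
        have := not_not.1 hx.2
        rwa [indicator_of_notMem (notMem_compl_iff.2 hx.1)] at this
      obtain ⟨r, hr, h⟩ := exists_dist_le_of_tendsto_density μ hB hf hv hε hε1 hline hx.1 hdens
      exact ⟨r, hr, fun z hz hzx => by push_cast; exact h z hz.1 hzx⟩)
  calc μH[(k : ℝ)] (f '' B) ≤ μH[(k : ℝ)] (f '' (B ∩ N)) + μH[(k : ℝ)] (f '' (B \ N)) := by
        rw [← inter_union_sdiff B N, image_union]
        simpa only [inter_union_sdiff] using measure_union_le _ _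
    _ ≤ _ := by
        rw [hnull, zero_add]
        refine hmain.trans ?_
        gcongr
        exact sdiff_subset

/-- The preceding type of bound passes from compact subsets to measurable sets. -/
theorem hausdorffMeasure_image_le_of_forall_isCompact {k : ℕ} {X : Type*} [MetricSpace X]
    [MeasurableSpace X] [BorelSpace X] {f : EuclideanSpace ℝ (Fin k) → X}
    {A : Set (EuclideanSpace ℝ (Fin k))} (hA : MeasurableSet A) (hfin : μH[(k : ℝ)] A ≠ ∞)
    {L : ℝ≥0} (hf : LipschitzOnWith L f A) {c : ℝ≥0∞}
    (h : ∀ B ⊆ A, IsCompact B → μH[(k : ℝ)] (f '' B) ≤ c * μH[(k : ℝ)] B) :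
    μH[(k : ℝ)] (f '' A) ≤ c * μH[(k : ℝ)] A := by
  refine ENNReal.le_of_forall_pos_le_add fun η hη _ => ?_
  -- Leaving out a set of measure less than `η / (l + 1)` costs at most `η` in the image.
  set l : ℝ≥0 := L ^ k
  obtain ⟨B, hBA, hB, hlt⟩ := hA.exists_isCompact_sdiff_lt hfin
    (ε := ((η / (l + 1) : ℝ≥0) : ℝ≥0∞)) (by
      have : 0 < η / (l + 1) := by positivity
      exact_mod_cast this.ne')
  have h1 := (hf.mono (sdiff_subset (t := B))).hausdorffMeasure_image_le (Nat.cast_nonneg k)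
  have h2 : (L : ℝ≥0∞) ^ (k : ℝ) * μH[(k : ℝ)] (A \ B) ≤ η := by
    calc (L : ℝ≥0∞) ^ (k : ℝ) * μH[(k : ℝ)] (A \ B) ≤ (l : ℝ≥0∞) * (η / (l + 1) : ℝ≥0) := by
          rw [ENNReal.rpow_natCast, ENNReal.coe_pow]; gcongr
      _ ≤ η := by
          rw [← ENNReal.coe_mul, ENNReal.coe_le_coe, ← mul_div_assoc, div_le_iff₀ (by positivity),
            mul_comm]
          gcongr
          exact le_self_add
  calc μH[(k : ℝ)] (f '' A) ≤ μH[(k : ℝ)] (f '' B) + μH[(k : ℝ)] (f '' (A \ B)) := by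
        refine (measure_mono ?_).trans (measure_union_le _ _)
        rw [← image_union, union_sdiff_cancel hBA]
    _ ≤ c * μH[(k : ℝ)] A + η := by
        gcongr
        · exact (h B hBA hB).trans (by gcongr)
        · exact h1.trans h2

/-! ### Countable test families and conclusion -/

/-- Functionals of norm at most `K` with a common nonzero kernel vector are uniformly small at some
member of any dense sequence of unit vectors. -/
theorem exists_dense_unit_forall_abs_apply_le {V : Type*} [NormedAddCommGroup V]
    [NormedSpace ℝ V] {u : ℕ → Metric.sphere (0 : V) 1} (hu : DenseRange u) {ι : Type*}
    {φ : ι → V →L[ℝ] ℝ} {K : ℝ≥0} (hφ : ∀ i, ‖φ i‖ ≤ K) {v : V} (hv : v ≠ 0)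
    (h : ∀ i, φ i v = 0) {ε : ℝ} (hε : 0 < ε) : ∃ j, ∀ i, |φ i (u j : V)| ≤ ε := by
  have hn : 0 < ‖v‖ := norm_pos_iff.2 hv
  have hmem : ‖v‖⁻¹ • v ∈ Metric.sphere (0 : V) 1 := by
    rw [mem_sphere_zero_iff_norm, norm_smul, norm_inv, norm_norm, inv_mul_cancel₀ hn.ne']
  -- One tolerance serves all `i` because the norms are uniformly bounded; the `+ 1` covers `K = 0`.
  obtain ⟨j, hj⟩ := hu.exists_dist_lt ⟨_, hmem⟩ (ε := ε / (K + 1)) (by positivity)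
  refine ⟨j, fun i => ?_⟩
  have e : φ i (u j : V) = φ i ((u j : V) - ‖v‖⁻¹ • v) := by
    rw [map_sub, map_smul, h i, smul_zero, sub_zero]
  have hd : ‖(u j : V) - ‖v‖⁻¹ • v‖ ≤ ε / (K + 1) := by
    rw [← dist_eq_norm, dist_comm]; exact hj.le
  rw [e, ← Real.norm_eq_abs]
  calc ‖φ i ((u j : V) - ‖v‖⁻¹ • v)‖ ≤ ‖φ i‖ * ‖(u j : V) - ‖v‖⁻¹ • v‖ := (φ i).le_opNorm _
    _ ≤ (K + 1) * (ε / (K + 1)) := by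
        gcongr
        exact (hφ i).trans (by linarith)
    _ = ε := by field_simp

/-- The distances to the points `g (e i)`, for a dense sequence `e i` in `E`, recover the distance
between points of `g(E)`. -/
theorem exists_dist_le_abs_dist_sub_dist {Z Y : Type*} [MetricSpace Z] [MetricSpace Y] {E : Set Z}
    {g : Z → Y} (hg : ContinuousOn g E) {e : ℕ → E} (he : DenseRange e) {x z : Z} (hx : x ∈ E)
    {η : ℝ} (hη : 0 < η) :
    ∃ i, dist (g x) (g z) ≤ |dist (g z) (g (e i)) - dist (g x) (g (e i))| + η := by
  have hcont : Continuous fun y : E => g y := continuousOn_iff_continuous_domRestrict.1 hg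
  have hopen : IsOpen {y : E | dist (g x) (g y) < η / 2} :=
    isOpen_lt (continuous_const.dist hcont) continuous_const
  -- With `g (e i)` within `η / 2` of `g x`, the triangle inequality loses at most twice that
  -- distance.
  obtain ⟨i, hi⟩ := he.exists_mem_open hopen ⟨⟨x, hx⟩, by simpa using half_pos hη⟩
  have hi' : dist (g x) (g (e i)) < η / 2 := hi
  refine ⟨i, ?_⟩
  have h1 := dist_triangle_right (g x) (g z) (g (e i))
  have h2 := le_abs_self (dist (g z) (g (e i)) - dist (g x) (g (e i)))
  linarith

/-- A weak BLD map does not send the Lipschitz image of a measurable subset of `ℝᵏ` with positive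
`k`-measure to a null set. -/
theorem hausdorffMeasure_image_eq_zero_of_weakBLD {X Y : Type*} [MetricSpace X] [MeasurableSpace X]
    [BorelSpace X] [MetricSpace Y] [MeasurableSpace Y] [BorelSpace Y] (hX : IsQuasiconvexSpace X)
    {Φ : X → Y} (hΦ : IsWeakBLD Φ) {k : ℕ} {E : Set (EuclideanSpace ℝ (Fin k))}
    (hE : MeasurableSet E) {f : EuclideanSpace ℝ (Fin k) → X} {L : ℝ≥0}
    (hf : LipschitzOnWith L f E) (h0 : μH[(k : ℝ)] (Φ '' (f '' E)) = 0) :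
    μH[(k : ℝ)] (f '' E) = 0 := by
  rcases E.eq_empty_or_nonempty with rfl | hne
  · simp
  obtain ⟨C, hC, hpath⟩ := hX.exists_lipschitz_paths
  obtain ⟨KΦ, hKΦ⟩ := hΦ.exists_lipschitzWith hX
  obtain ⟨M, hM, hBLD⟩ := hΦ
  set g := Φ ∘ f with hg
  have hgL : LipschitzOnWith (KΦ * L) g E := hKΦ.comp_lipschitzOnWith hf
  have := hne.to_subtype
  obtain ⟨e, he⟩ := TopologicalSpace.exists_dense_seq E
  -- The distance functions are extended to the whole space so that Rademacher's theorem and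
  -- restriction to full lines apply.
  have hext : ∀ i, ∃ G : EuclideanSpace ℝ (Fin k) → ℝ, LipschitzWith (KΦ * L) G ∧
      EqOn (fun x => dist (g x) (g (e i))) G E := fun i =>
    LipschitzOnWith.extend_real (by
      have := (LipschitzWith.dist_left (g (e i))).comp_lipschitzOnWith hgL
      rwa [one_mul] at this)
  choose G hGL hGE using hext
  have hnull : ∀ S ⊆ E, μH[(k : ℝ)] S = 0 → μH[(k : ℝ)] (f '' S) = 0 := by
    intro S hS hS0
    have := (hf.mono hS).hausdorffMeasure_image_le (Nat.cast_nonneg k)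
    rw [hS0, mul_zero] at this
    exact nonpos_iff_eq_zero.1 this
  -- the points of differentiability
  set E₁ := {x ∈ E | ∀ i, DifferentiableAt ℝ (G i) x} with hE₁
  have hE₁E : E₁ ⊆ E := fun x hx => hx.1
  have hE₁m : MeasurableSet E₁ := by
    have : E₁ = E ∩ ⋂ i, {x | DifferentiableAt ℝ (G i) x} := by ext x; simp [hE₁]
    rw [this]
    exact hE.inter (MeasurableSet.iInter fun i => measurableSet_of_differentiableAt ℝ (G i))
  have hdiff : μH[(k : ℝ)] (E \ E₁) = 0 := by
    refine measure_mono_null (t := ⋃ i, {x | ¬ DifferentiableAt ℝ (G i) x}) (fun x hx => ?_)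
      (measure_iUnion_null fun i => (hGL i).ae_differentiableAt)
    by_contra hcon
    simp only [mem_iUnion, mem_ofPred_eq, not_exists, not_not] at hcon
    exact hx.2 ⟨hx.1, hcon⟩
  have hker : μH[(k : ℝ)] {x ∈ E₁ | ¬ ∃ v, v ≠ 0 ∧ ∀ i, fderiv ℝ (G i) x v = 0} = 0 :=
    hausdorffMeasure_forall_exists_fderiv_ne_zero_eq_zero (g := g) (y := fun i => g (e i))
      (fun i x hx => hx.2 i) (fun i x hx => (hGE i hx.1).symm)
      (measure_mono_null (image_mono hE₁E) (by rw [hg, image_comp]; exact h0))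
  set D : ℝ≥0 := M * (1 + KΦ * (C * L)) with hD
  set c : ℝ≥0∞ := ((5 * (6 * L + 2 * D) : ℝ≥0) : ℝ≥0∞) ^ (k : ℝ) with hc
  have hc_top : c ≠ ∞ := ENNReal.rpow_ne_top_of_nonneg (Nat.cast_nonneg k) ENNReal.coe_ne_top
  -- Compactness of `B` makes its slices by lines closed, as the filling of gaps requires.
  have hcompact : ∀ (v : EuclideanSpace ℝ (Fin k)) (ε : ℝ), ‖v‖ = 1 → 0 < ε → ε ≤ 1 → ∀ B ⊆ E₁,
      IsCompact B → (∀ x ∈ B, ∀ i, |fderiv ℝ (G i) x v| ≤ ε) →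
      μH[(k : ℝ)] (f '' B) ≤ c * ENNReal.ofReal ε * μH[(k : ℝ)] B := by
    intro v ε hv hε hε1 B hBE hB hBv
    rw [mul_assoc]
    refine hausdorffMeasure_image_le_of_line_dist_le hB.measurableSet
      (hf.mono (hBE.trans hE₁E)) hv hε hε1 fun p a b hab ha hb => ?_
    have hlin : LipschitzWith 1 fun s : ℝ => p + s • v := LipschitzWith.of_dist_le_mul fun s t => by
      rw [dist_add_left, dist_eq_norm, ← sub_smul, norm_smul, hv, mul_one, NNReal.coe_one, one_mul,
        dist_eq_norm]
    have hbound := dist_le_of_weakBLD (h := fun s => f (p + s • v)) (L := L) (K := KΦ * (C * L))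
      (F := {s : ℝ | p + s • v ∈ B}) (G := fun i s => G i (p + s • v)) (ε := ε) hM
      (fun a b γ hγ => (hBLD a b γ hγ).1) hC hKΦ hpath (hB.isClosed.preimage hlin.continuous)
      ha hb hab (by
        have := (hf.mono (hBE.trans hE₁E)).comp hlin.lipschitzOnWith
          (s := {s : ℝ | p + s • v ∈ B}) (fun s hs => hs)
        rwa [mul_one] at this) le_rfl
      (fun i => by
        refine ((hGL i).comp hlin).weaken ?_
        rw [mul_one]
        gcongr
        exact le_mul_of_one_le_left zero_le hC) hε.le
      (fun i s hs => by
        have h1 : HasDerivAt (fun s : ℝ => p + s • v) v s := by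
          simpa using ((hasDerivAt_id s).smul_const v).const_add p
        have h2 := ((hBE hs).2 i).hasFDerivAt.comp_hasDerivAt s h1
        have h3 : deriv (fun s : ℝ => G i (p + s • v)) s = fderiv ℝ (G i) (p + s • v) v := h2.deriv
        rw [h3]
        exact hBv _ hs i)
      (fun s hs t ht η hη => by
        have hsE := hE₁E (hBE hs)
        have htE := hE₁E (hBE ht)
        obtain ⟨i, hi⟩ := exists_dist_le_abs_dist_sub_dist (z := p + t • v)
          hgL.continuousOn he hsE hη
        refine ⟨i, ?_⟩
        rw [← hGE i hsE, ← hGE i htE]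
        exact hi)
    refine hbound.trans ?_
    have hab' := sub_nonneg.2 hab
    have h1 : (0 : ℝ) ≤ volume.real (Ioc a b \ {s : ℝ | p + s • v ∈ B}) := measureReal_nonneg
    have h2 : (0 : ℝ) ≤ KΦ * (C * L) := by positivity
    have h3 : ε * (b - a) + KΦ * (C * L) * volume.real (Ioc a b \ {s : ℝ | p + s • v ∈ B}) ≤
        (1 + KΦ * (C * L)) *
          (ε * (b - a) + volume.real (Ioc a b \ {s : ℝ | p + s • v ∈ B})) := by
      nlinarith [mul_nonneg h2 (mul_nonneg hε.le hab')]
    have h4 := mul_le_mul_of_nonneg_left h3 M.coe_nonneg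
    rw [hD]
    push_cast
    rwa [mul_assoc (M : ℝ)]
  have hE₁0 : μH[(k : ℝ)] (f '' E₁) = 0 := by
    -- In dimension zero no kernel vector exists, so `hker` says that `E₁` itself is null.
    by_cases hsph : ∃ v : EuclideanSpace ℝ (Fin k), v ≠ 0
    swap
    · refine hnull _ hE₁E (measure_mono_null ?_ hker)
      refine fun x hx => ⟨hx, ?_⟩
      rintro ⟨v, hv, -⟩
      exact hsph ⟨v, hv⟩
    have : Nontrivial (EuclideanSpace ℝ (Fin k)) := ⟨⟨hsph.choose, 0, hsph.choose_spec⟩⟩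
    have : Nonempty (Metric.sphere (0 : EuclideanSpace ℝ (Fin k)) 1) :=
      (NormedSpace.sphere_nonempty.2 zero_le_one).to_subtype
    obtain ⟨u, hu⟩ := TopologicalSpace.exists_dense_seq
      (Metric.sphere (0 : EuclideanSpace ℝ (Fin k)) 1)
    -- Bounded pieces have finite measure, so the bound tends to zero with `ε`.
    have hball : ∀ n : ℕ, μH[(k : ℝ)] (f '' (E₁ ∩ Metric.ball 0 n)) = 0 := by
      intro n
      set E₂ := E₁ ∩ Metric.ball 0 (n : ℝ)
      have hE₂m : MeasurableSet E₂ := hE₁m.inter Metric.isOpen_ball.measurableSet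
      have hE₂fin : μH[(k : ℝ)] E₂ ≠ ∞ :=
        ((measure_mono inter_subset_right).trans_lt measure_ball_lt_top).ne
      have hE₂E : E₂ ⊆ E := inter_subset_left.trans hE₁E
      have hεbound : ∀ ε : ℝ, 0 < ε → ε ≤ 1 →
          μH[(k : ℝ)] (f '' E₂) ≤ c * ENNReal.ofReal ε * μH[(k : ℝ)] E₂ := by
        intro ε hε hε1
        -- The kernel vector varies with the point; on `Q j` it is replaced by the fixed direction
        -- `u j`, at cost `ε`.
        set Q : ℕ → Set (EuclideanSpace ℝ (Fin k)) := fun j =>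
          E₂ ∩ ⋂ i, {x | |fderiv ℝ (G i) x (u j)| ≤ ε} with hQ
        have hQm : ∀ j, MeasurableSet (Q j) := fun j =>
          hE₂m.inter (MeasurableSet.iInter fun i =>
            measurableSet_le (measurable_fderiv_apply_const ℝ (G i) (u j : _)).abs
              measurable_const)
        have hSm : ∀ j, MeasurableSet (disjointed Q j) := MeasurableSet.disjointed hQm
        have hSQ : ∀ j, disjointed Q j ⊆ Q j := disjointed_subset Q
        have hSE : ∀ j, disjointed Q j ⊆ E₂ := fun j => (hSQ j).trans inter_subset_left
        have hrest : μH[(k : ℝ)] (f '' (E₂ \ ⋃ j, disjointed Q j)) = 0 := by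
          refine hnull _ (sdiff_subset.trans hE₂E) (measure_mono_null ?_ hker)
          refine fun x hx => ⟨hx.1.1, ?_⟩
          rintro ⟨v, hv, hv0⟩
          obtain ⟨j, hj⟩ := exists_dense_unit_forall_abs_apply_le hu (K := KΦ * L)
            (fun i => norm_fderiv_le_of_lipschitz ℝ (hGL i) (x₀ := x)) hv hv0 hε
          refine hx.2 ?_
          rw [iUnion_disjointed]
          exact mem_iUnion.2 ⟨j, hx.1, mem_iInter.2 hj⟩
        have hpiece : ∀ j, μH[(k : ℝ)] (f '' disjointed Q j) ≤
            c * ENNReal.ofReal ε * μH[(k : ℝ)] (disjointed Q j) := fun j =>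
          hausdorffMeasure_image_le_of_forall_isCompact (hSm j)
            (measure_ne_top_of_subset (hSE j) hE₂fin) (hf.mono ((hSE j).trans hE₂E))
            fun B hBS hB => hcompact (u j) ε (mem_sphere_zero_iff_norm.1 (u j).2) hε hε1 B
              (hBS.trans ((hSE j).trans inter_subset_left)) hB
              fun x hx i => mem_iInter.1 (hSQ j (hBS hx)).2 i
        calc μH[(k : ℝ)] (f '' E₂)
            ≤ μH[(k : ℝ)] (f '' (E₂ \ ⋃ j, disjointed Q j)) +
              μH[(k : ℝ)] (⋃ j, f '' disjointed Q j) := by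
              refine (measure_mono ?_).trans (measure_union_le _ _)
              rw [← image_iUnion, ← image_union]
              exact image_mono fun x hx => by
                by_cases h : x ∈ ⋃ j, disjointed Q j
                · exact Or.inr h
                · exact Or.inl ⟨hx, h⟩
          _ ≤ ∑' j, c * ENNReal.ofReal ε * μH[(k : ℝ)] (disjointed Q j) := by
              rw [hrest, zero_add]
              exact (measure_iUnion_le _).trans (ENNReal.tsum_le_tsum hpiece)
          _ = c * ENNReal.ofReal ε * μH[(k : ℝ)] (⋃ j, disjointed Q j) := by
              rw [ENNReal.tsum_mul_left, measure_iUnion (disjoint_disjointed _) hSm]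
          _ ≤ c * ENNReal.ofReal ε * μH[(k : ℝ)] E₂ := by
              gcongr
              exact iUnion_subset hSE
      have hlim : Tendsto (fun ε : ℝ => c * ENNReal.ofReal ε * μH[(k : ℝ)] E₂) (𝓝[>] 0) (𝓝 0) := by
        have h1 : Tendsto (fun ε : ℝ => ENNReal.ofReal ε) (𝓝[>] 0) (𝓝 0) := by
          simpa using (ENNReal.continuous_ofReal.tendsto 0).mono_left nhdsWithin_le_nhds
        have h2 := ENNReal.Tendsto.mul_const
          (ENNReal.Tendsto.const_mul h1 (Or.inr hc_top)) (Or.inr hE₂fin)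
        simpa using h2
      refine nonpos_iff_eq_zero.1 (ge_of_tendsto hlim ?_)
      filter_upwards [Ioc_mem_nhdsGT zero_lt_one] with ε hε using hεbound ε hε.1 hε.2
    have hcov : f '' E₁ ⊆ ⋃ n : ℕ, f '' (E₁ ∩ Metric.ball 0 n) := by
      rw [← image_iUnion, ← inter_iUnion, Metric.iUnion_ball_nat, inter_univ]
    exact measure_mono_null hcov (measure_iUnion_null hball)
  refine measure_mono_null ?_ (measure_union_null hE₁0 (hnull _ sdiff_subset hdiff))
  rw [← image_union, union_sdiff_cancel hE₁E]

theorem theorem1p1 {X Y : Type*}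
    [MetricSpace X] [CompleteSpace X] [MeasurableSpace X] [BorelSpace X]
    [MetricSpace Y] [MeasurableSpace Y] [BorelSpace Y]
    (hX : IsQuasiconvexSpace X) (Φ : X → Y) (hΦ : IsWeakBLD Φ)
    (k : ℕ) (E : Set (EuclideanSpace ℝ (Fin k))) (hE : NullMeasurableSet E volume)
    (f : E → X) (hf : ∃ L : ℝ≥0, LipschitzWith L f) :
    μH[(k : ℝ)] (Set.range f) = 0 ↔ μH[(k : ℝ)] (Φ '' Set.range f) = 0 := by
  constructor
  · intro h
    obtain ⟨K, hK⟩ := hΦ.exists_lipschitzWith hX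
    have := hK.hausdorffMeasure_image_le (Nat.cast_nonneg k) (Set.range f)
    rw [h, mul_zero] at this
    exact nonpos_iff_eq_zero.1 this
  · intro h
    rcases isEmpty_or_nonempty E with hemp | ⟨⟨x₀⟩⟩
    · simp [range_eq_empty f]
    obtain ⟨L, hL⟩ := hf
    classical
    set F : EuclideanSpace ℝ (Fin k) → X := fun x => if hx : x ∈ E then f ⟨x, hx⟩ else f x₀
    have hFE : ∀ x : E, F x = f x := fun x => by simp [F]
    have hFL : LipschitzOnWith L F E := by
      rw [lipschitzOnWith_iff_restrict]
      convert hL using 1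
      exact funext hFE
    have hrange : range f = F '' E := by
      ext z
      constructor
      · rintro ⟨x, rfl⟩; exact ⟨x, x.2, hFE x⟩
      · rintro ⟨x, hx, rfl⟩; exact ⟨⟨x, hx⟩, (hFE ⟨x, hx⟩).symm⟩
    rw [hrange] at h ⊢
    -- The part of `E` outside a Borel subset of full measure is null, and so is its Lipschitz
    -- image.
    obtain ⟨E', hE'E, hE'm, hE'ae⟩ := hE.exists_measurable_subset_ae_eq
    have hdiff : volume (E \ E') = 0 := (ae_le_set.1 hE'ae.symm.le)
    have hdiff' : μH[(k : ℝ)] (E \ E') = 0 :=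
      Measure.absolutelyContinuous_isAddHaarMeasure _ volume hdiff
    have h1 := hausdorffMeasure_image_eq_zero_of_weakBLD hX hΦ hE'm (hFL.mono hE'E)
      (measure_mono_null (image_mono (image_mono hE'E)) h)
    have h2 : μH[(k : ℝ)] (F '' (E \ E')) = 0 := by
      have := (hFL.mono (sdiff_subset (t := E'))).hausdorffMeasure_image_le (Nat.cast_nonneg k)
      rw [hdiff', mul_zero] at this
      exact nonpos_iff_eq_zero.1 this
    refine measure_mono_null ?_ (measure_union_null h1 h2)
    rw [← image_union, union_sdiff_cancel hE'E]
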